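/- Let $(R,\mathfrak m)$ be a (commutative Noetherian) local ring, $M$ a finitely generated $R$-module of dimension $d$, and $x_1,\ldots,x_d$ a system of parameters for $M$. Suppose that $M$ is Cohen–Macaulay. Then for every $n\ge 1$ there is an isomorphism of $R$-modules $$\alpha_n:\ M/(x_1^n,\ldots,x_d^n)M\longrightarrow 0:_{H^d_{\mathfrak m}(M)}(x_1^n,\ldots,x_d^n),$$ and these isomorphisms can be chosen so that, for all $n\ge 1$, $$\alpha_n\circ\nu_n=(x_1\cdots x_d)\cdot\alpha_{n+1},$$ where $\nu_n: M/(x_1^{n+1},\ldots,x_d^{n+1})M\to M/(x_1^n,\ldots,x_d^n)M$ is the natural projection. Here $H^d_{\mathfrak m}(M)$ is the $d$-th local cohomology module of $M$ with support in $\mathfrak m$, $0:_X I=\{z\in X: Iz=0\}$ for an ideal $I$, and $(x_1\cdots x_d)\cdot$ denotes the map $0:_{H^d_{\mathfrak m}(M)}(x_1^{n+1},\ldots,x_d^{n+1})\to 0:_{H^d_{\mathfrak m}(M)}(x_1^n,\ldots,x_d^n)$ given by multiplication by $x_1\cdots x_d$. -/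

import Mathlib

universe u

noncomputable section

namespace CMLocalCohomology

open IsLocalRing

/-- The depth of a module over a local ring: the supremum of the lengths of the `M`-regular
sequences contained in the maximal ideal. -/
def depth (R M : Type*) [CommRing R] [IsLocalRing R] [AddCommGroup M] [Module R M] : ℕ∞ :=
  ⨆ (rs : List R) (_ : (∀ r ∈ rs, r ∈ maximalIdeal R) ∧ RingTheory.Sequence.IsRegular M rs),
    (rs.length : ℕ∞)

/-- A finitely generated module `M` over a Noetherian local ring is Cohen–Macaulay if it is zero
or if its depth equals its Krull dimension (the dimension of its support). -/
def IsCohenMacaulay (R M : Type*) [CommRing R] [IsLocalRing R] [AddCommGroup M] [Module R M] :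
    Prop :=
  Nontrivial M → (depth R M : WithBot ℕ∞) = Module.supportDim R M

/-- The ideal `(x₁ⁿ, …, x_dⁿ)`. -/
def powIdeal {R : Type*} [CommRing R] {d : ℕ} (x : Fin d → R) (n : ℕ) : Ideal R :=
  Ideal.span (Set.range fun i => x i ^ n)

/-- `x₁, …, x_d` is a system of parameters for `M`: the number `d` of elements is the dimension
of `M`, they lie in the maximal ideal, and `M/(x₁, …, x_d)M` has finite length. -/
structure IsSystemOfParameters {R : Type*} [CommRing R] [IsLocalRing R] (M : Type*)
    [AddCommGroup M] [Module R M] {d : ℕ} (x : Fin d → R) : Prop where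
  dim_eq : Module.supportDim R M = (d : WithBot ℕ∞)
  mem_maximalIdeal : ∀ i, x i ∈ maximalIdeal R
  finite_length : IsFiniteLength R (M ⧸ (Ideal.span (Set.range x) • ⊤ : Submodule R M))

/-- The top local cohomology module `H^d_𝔪(M)`, or more generally `H^i_𝔪(M)`. -/
abbrev H {R : Type u} [CommRing R] [IsLocalRing R] (i : ℕ) (M : Type u) [AddCommGroup M]
    [Module R M] : ModuleCat.{u} R :=
  (localCohomology (maximalIdeal R) i).obj (ModuleCat.of R M)

section Maps

variable {R : Type*} [CommRing R] {d : ℕ} (x : Fin d → R) (n : ℕ)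
variable (M : Type*) [AddCommGroup M] [Module R M]

theorem powIdeal_succ_le : powIdeal x (n + 1) ≤ powIdeal x n := by
  refine Ideal.span_le.2 ?_
  rintro _ ⟨i, rfl⟩
  simp only [SetLike.mem_coe, pow_succ]
  exact Ideal.mul_mem_right _ _ (Ideal.subset_span ⟨i, rfl⟩)

/-- The quotient `M/(x₁ⁿ, …, x_dⁿ)M`. -/
abbrev QuotPow : Type _ := M ⧸ (powIdeal x n • ⊤ : Submodule R M)

/-- The submodule `0 :_M (x₁ⁿ, …, x_dⁿ)` of the elements killed by `(x₁ⁿ, …, x_dⁿ)`. -/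
abbrev annPow : Submodule R M := Submodule.torsionBySet R M (powIdeal x n)

/-- The natural projection `M/(x₁ⁿ⁺¹, …, x_dⁿ⁺¹)M → M/(x₁ⁿ, …, x_dⁿ)M`. -/
def natProj : QuotPow x (n + 1) M →ₗ[R] QuotPow x n M :=
  Submodule.factor (Submodule.smul_mono_left (powIdeal_succ_le x n))

theorem prod_smul_mem_annPow (m : M) (hm : m ∈ annPow x (n + 1) M) :
    (LinearMap.lsmul R M (∏ i, x i)) m ∈ annPow x n M := by
  unfold annPow powIdeal at *
  rw [← Submodule.torsionBySet_eq_torsionBySet_span] at *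
  rw [Submodule.mem_torsionBySet_iff] at *
  rintro ⟨_, i, rfl⟩
  have h := hm ⟨_, i, rfl⟩
  simp only [LinearMap.lsmul_apply] at h ⊢
  obtain ⟨c, hc⟩ := Finset.dvd_prod_of_mem x (Finset.mem_univ i)
  rw [hc, smul_smul, show x i ^ n * (x i * c) = c * x i ^ (n + 1) by ring, mul_smul, h, smul_zero]

/-- Multiplication by `x₁ ⋯ x_d` as a map
`0 :_M (x₁ⁿ⁺¹, …, x_dⁿ⁺¹) → 0 :_M (x₁ⁿ, …, x_dⁿ)`. -/
def mulProd : annPow x (n + 1) M →ₗ[R] annPow x n M :=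
  (LinearMap.lsmul R M (∏ i, x i)).restrict (prod_smul_mem_annPow x n M)

end Maps

end CMLocalCohomology

end

/-! Write `W_n = M/(x₁ⁿ, …, x_dⁿ)M`. Since `M` is Cohen–Macaulay, the powers `x_iⁿ` form an
`M`-regular sequence (`IsSystemOfParameters.isWeaklyRegular_pow`). Dividing by one power at a time
and splicing the resulting extensions gives a class `ξ_n ∈ Ext^d(W_n, M)`. If `Ext^l(N, M) = 0` for
`l < d`, composition with `ξ_n` embeds `Hom(N, W_n)` in `Ext^d(N, M)`, and is onto when `(x₁ⁿ, …,
x_dⁿ)` kills `N`. Moreover `ξ_{n+1}` pulls back to `ξ_n` along multiplication by `x₁⋯x_d : W_n →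
W_{n+1}`. All this is `exists_ext_classes`.

The module `H^d_𝔪(M)` is the colimit of `Ext^d(R/𝔪ᵗ, M)`. An element `w` of `W_n` is killed by some
`𝔪ᵗ`, hence is a map `R/𝔪ᵗ → W_n`; composing with `ξ_n` and passing to the colimit defines `α_n(w)`.
It is injective because composition with `ξ_n` is injective at every stage. Every class lies in the
image of some `α_k`, since high powers of the `x_i` kill `R/𝔪ᵗ`. If `α_k(w)` is killed by the
`x_iⁿ`, so is `w`; its map then factors through a cyclic module killed by them, and the class comes
from `W_n`. The compatibility is `α_{n+1}(x₁⋯x_d w) = α_n(w)`. -/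

noncomputable section

open CategoryTheory Limits Opposite

universe v w

/-! ### Comparison of derived-functor `Ext` with `Abelian.Ext`, naturally in the first argument. -/

namespace CategoryTheory

section
variable {C : Type*} [Category* C] [Abelian C] {ι : Type*} {c : ComplexShape ι}

lemma homologyUnop_inv_naturality {K L : HomologicalComplex Cᵒᵖ c} (φ : K ⟶ L) (i : ι) :
    (HomologicalComplex.homologyMap φ i).unop ≫ (HomologicalComplex.homologyUnop K i).inv =
      (HomologicalComplex.homologyUnop L i).inv ≫
        HomologicalComplex.homologyMap (L := K.unop) (K := L.unop)
          ((HomologicalComplex.unopFunctor C c).map φ.op) i := by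
  rw [Iso.eq_inv_comp, ← Category.assoc, Iso.comp_inv_eq]
  have h := HomologicalComplex.homologyOp_hom_naturality (K := L.unop) (L := K.unop)
    ((HomologicalComplex.unopFunctor C c).map φ.op) i
  exact congrArg Quiver.Hom.unop h

end

namespace ProjectiveResolution
open Abelian
variable {R : Type w} [Ring R] {C : Type u} [Category.{v} C] [Abelian C] [Linear R C]
variable {X : C} (P : ProjectiveResolution X)

lemma smul_extMk [HasExt.{v} C] {Y : C} {n : ℕ} (r : R) (f : P.complex.X n ⟶ Y) (m : ℕ)
    (hm : n + 1 = m) (hf : P.complex.d m n ≫ f = 0) :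
    r • P.extMk f m hm hf = P.extMk (r • f) m hm (by simp [hf]) := by
  rw [Ext.smul_eq_comp_mk₀, P.extMk_comp_mk₀]
  simp

variable (R) in
/-- The morphisms `Pₙ ⟶ Y` which vanish after composition with `Pₙ₊₁ ⟶ Pₙ`. -/
def cocycles (n : ℕ) (Y : C) : Submodule R (P.complex.X n ⟶ Y) :=
  LinearMap.ker (Linear.leftComp R Y (P.complex.d (n + 1) n))

variable (R) in
/-- The extension class of a cocycle, as a linear map. -/
def extMkHom [HasExt.{v} C] (n : ℕ) (Y : C) : P.cocycles R n Y →ₗ[R] Ext X Y n where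
  toFun f := P.extMk f.1 (n + 1) rfl f.2
  map_add' f g := (P.add_extMk _ _ _ _ f.2 g.2).symm
  map_smul' r f := (P.smul_extMk r _ _ _ f.2).symm

variable (R) in
/-- The comparison of the cycles of the complex `Hom(P, Y)` with the cocycles `Pₙ ⟶ Y`. -/
def cyclesToCocycles (n : ℕ) (Y : C) :
    (P.complex.linearYonedaObj R Y).cycles n ⟶ ModuleCat.of R (P.cocycles R n Y) :=
  ModuleCat.ofHom (((P.complex.linearYonedaObj R Y).iCycles n).hom.codRestrict _ fun z ↦
    congr($((P.complex.linearYonedaObj R Y).iCycles_d n (n + 1)) z))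

lemma extMk_congr [HasExt.{v} C] {Y : C} {n : ℕ} {f g : P.complex.X n ⟶ Y} (h : f = g)
    (hf : P.complex.d (n + 1) n ≫ f = 0) (hg : P.complex.d (n + 1) n ≫ g = 0) :
    P.extMk f (n + 1) rfl hf = P.extMk g (n + 1) rfl hg := by
  subst h
  rfl

lemma extMk_d_comp [HasExt.{v} C] {Y : C} (n j : ℕ) (g : P.complex.X j ⟶ Y) :
    P.extMk (P.complex.d n j ≫ g) (n + 1) rfl (by simp) = 0 := by
  by_cases h : j + 1 = n
  · exact (P.extMk_eq_zero_iff _ _ rfl _ j h).2 ⟨g, rfl⟩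
  · have h0 : P.complex.d n j = 0 := P.complex.shape _ _ h
    simp [h0]

lemma eq_zero_of_extMk_zero_eq_zero [HasExt.{v} C] {Y : C} (f : P.complex.X 0 ⟶ Y)
    (hf : P.complex.d 1 0 ≫ f = 0) (h : P.extMk f 1 rfl hf = 0) : f = 0 := by
  simp only [← P.extEquivCohomologyClass.apply_eq_iff_eq,
    extEquivCohomologyClass_extMk, extEquivCohomologyClass_zero,
    CochainComplex.HomComplex.CohomologyClass.mk_eq_zero_iff] at h
  rw [CochainComplex.HomComplex.Cocycle.toSingleMk_mem_coboundaries_iff _ _ _ _ _ 1 (by lia)] at h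
  obtain ⟨g, hg⟩ := h
  -- A bounding cochain starts in degree 1, but the resolution lives in degrees at most 0.
  have h0 : g = 0 := (P.cochainComplex.isZero_of_isStrictlyLE 0 1).eq_of_src _ _
  rw [h0, comp_zero] at hg
  rw [← cancel_epi (P.cochainComplexXIso (-(0 : ℕ)) 0 rfl).hom, ← hg, comp_zero]

lemma exists_of_extMk_eq_zero [HasExt.{v} C] {Y : C} (n : ℕ) (f : P.complex.X n ⟶ Y)
    (hf : P.complex.d (n + 1) n ≫ f = 0) (h : P.extMk f (n + 1) rfl hf = 0) :
    ∃ g : P.complex.X ((ComplexShape.up ℕ).prev n) ⟶ Y, P.complex.d n _ ≫ g = f := by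
  cases n with
  -- Here `prev 0` is the default value 0, so there is no genuine coboundary and `f` itself must
  -- vanish.
  | zero => exact ⟨0, by rw [P.eq_zero_of_extMk_zero_eq_zero f hf h, comp_zero]⟩
  | succ n =>
    rw [(by simp : (ComplexShape.up ℕ).prev (n + 1) = n)]
    exact (P.extMk_eq_zero_iff _ _ rfl _ n rfl).1 h

variable (R) in
/-- The comparison map from the cohomology of `Hom(P, Y)` to `Abelian.Ext X Y n`. -/
def homologyToExt [HasExt.{v} C] (n : ℕ) (Y : C) :
    (P.complex.linearYonedaObj R Y).homology n ⟶ ModuleCat.of R (Ext X Y n) :=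
  ((P.complex.linearYonedaObj R Y).sc n).descHomology
    (P.cyclesToCocycles R n Y ≫ ModuleCat.ofHom (P.extMkHom R n Y)) <| by
    ext g
    have key : (P.complex.linearYonedaObj R Y).iCycles n
        (((P.complex.linearYonedaObj R Y).sc n).toCycles g) =
        (P.complex.linearYonedaObj R Y).d _ n g :=
      congr($((P.complex.linearYonedaObj R Y).toCycles_i _ n) g)
    exact (P.extMk_congr (g := P.complex.d n _ ≫ g) key
      (P.cyclesToCocycles R n Y _).2
      ((P.complex.d_comp_d_assoc _ _ _ g).trans zero_comp)).trans (P.extMk_d_comp n _ g)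

lemma homologyπ_homologyToExt [HasExt.{v} C] (n : ℕ) (Y : C) :
    (P.complex.linearYonedaObj R Y).homologyπ n ≫ P.homologyToExt R n Y =
      P.cyclesToCocycles R n Y ≫ ModuleCat.ofHom (P.extMkHom R n Y) :=
  ShortComplex.π_descHomology _ _ _

lemma cyclesToCocycles_surjective (n : ℕ) (Y : C) :
    Function.Surjective (P.cyclesToCocycles R n Y) := by
  intro f
  let k : ModuleCat.of R (P.cocycles R n Y) ⟶ (P.complex.linearYonedaObj R Y).X n :=
    ModuleCat.ofHom (Submodule.subtype _)
  have hk : k ≫ (P.complex.linearYonedaObj R Y).d n (n + 1) = 0 := by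
    ext f
    exact f.2
  refine ⟨(P.complex.linearYonedaObj R Y).liftCycles k (n + 1) (by simp) hk f, ?_⟩
  apply Subtype.ext
  exact congr($((P.complex.linearYonedaObj R Y).liftCycles_i k (n + 1) (by simp) hk) f)

/-- A cocycle with zero extension class is a coboundary, and every extension class is represented by
a cocycle. -/
instance [HasExt.{v} C] (n : ℕ) (Y : C) : IsIso (P.homologyToExt R n Y) := by
  have hπ (z) : P.homologyToExt R n Y ((P.complex.linearYonedaObj R Y).homologyπ n z) =
      P.extMkHom R n Y (P.cyclesToCocycles R n Y z) :=
    congr($(P.homologyπ_homologyToExt n Y) z)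
  rw [ConcreteCategory.isIso_iff_bijective]
  refine ⟨(injective_iff_map_eq_zero (P.homologyToExt R n Y).hom).2 fun h hh ↦ ?_, fun α ↦ ?_⟩
  · obtain ⟨z, rfl⟩ := (ModuleCat.epi_iff_surjective
      ((P.complex.linearYonedaObj R Y).homologyπ n)).1 inferInstance h
    obtain ⟨g, hg⟩ := P.exists_of_extMk_eq_zero n _ (P.cyclesToCocycles R n Y z).2
      ((hπ z).symm.trans hh)
    have hz : z = (P.complex.linearYonedaObj R Y).toCycles _ n g := by
      apply (ModuleCat.mono_iff_injective ((P.complex.linearYonedaObj R Y).iCycles n)).1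
        inferInstance
      refine Eq.trans hg.symm ?_
      exact congr($((P.complex.linearYonedaObj R Y).toCycles_i _ n) g).symm
    rw [hz]
    exact congr($((P.complex.linearYonedaObj R Y).toCycles_comp_homologyπ _ n) g)
  · obtain ⟨f, hf, rfl⟩ := P.extMk_surjective α (n + 1) rfl
    obtain ⟨z, hz⟩ := P.cyclesToCocycles_surjective (R := R) n Y ⟨f, hf⟩
    exact ⟨_, (hπ z).trans (by rw [hz]; rfl)⟩

/-- A lift of a morphism to projective resolutions. -/
def homOfLift {X' : C} (P' : ProjectiveResolution X') (g : X' ⟶ X) : Hom P' P g where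
  hom := lift g P' P
  hom_f_zero_comp_π_f_zero := by simpa using lift_commutes_zero g P' P

/-- The map `ψ` is kept abstract because in the application it arises by passing through the
opposite category; only its values matter. -/
lemma homologyMap_homologyToExt {R : Type w} [CommRing R] [Linear R C] [HasExt.{v} C] {X' : C}
    {P' : ProjectiveResolution X'} {g : X' ⟶ X} (φ : Hom P' P g) (n : ℕ) (Y : C)
    (ψ : P.complex.linearYonedaObj R Y ⟶ P'.complex.linearYonedaObj R Y)
    (hψ : ∀ f : P.complex.X n ⟶ Y, ψ.f n f = φ.hom.f n ≫ f) :
    HomologicalComplex.homologyMap ψ n ≫ P'.homologyToExt R n Y =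
      P.homologyToExt R n Y ≫
        ModuleCat.ofHom ((Ext.mk₀ g).precompOfLinear R Y (zero_add n)) := by
  rw [← cancel_epi ((P.complex.linearYonedaObj R Y).homologyπ n),
    HomologicalComplex.homologyπ_naturality_assoc, homologyπ_homologyToExt,
    ← Category.assoc _ (P.homologyToExt R n Y), homologyπ_homologyToExt]
  ext z
  refine Eq.trans ?_ (mk₀_comp_extMk (P.cyclesToCocycles R n Y z).1 (n + 1) rfl
    (P.cyclesToCocycles R n Y z).2 φ).symm
  refine P'.extMk_congr ?_ (P'.cyclesToCocycles R n Y _).2 _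
  refine Eq.trans ?_ (hψ _)
  exact congr($(HomologicalComplex.cyclesMap_i ψ n) z)

variable (R) in
/-- The `Ext` defined by left derived functors is isomorphic to `Abelian.Ext`. -/
def extIsoExt [EnoughProjectives C] [HasExt.{v} C] (n : ℕ) (Y : C) :
    ((_root_.Ext R C n).obj (op X)).obj Y ≅ ModuleCat.of R (Ext X Y n) :=
  P.isoExt n Y ≪≫ asIso (P.homologyToExt R n Y)

lemma extIsoExt_naturality {R : Type w} [CommRing R] [Linear R C] [EnoughProjectives C]
    [HasExt.{v} C] {X' : C} (P' : ProjectiveResolution X') (g : X' ⟶ X) (n : ℕ) (Y : C) :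
    ((_root_.Ext R C n).map g.op).app Y ≫ (P'.extIsoExt R n Y).hom =
      (P.extIsoExt R n Y).hom ≫
        ModuleCat.ofHom ((Ext.mk₀ g).precompOfLinear R Y (zero_add n)) := by
  -- Three squares are pasted: independence of the resolution (`h1`), homology against `unop`
  -- (`h2`), and the passage to extension classes (`h3`).
  let F := ((linearYoneda R C).obj Y).rightOp
  let φ := P.homOfLift P' g
  have h1 := isoLeftDerivedObj_inv_naturality g P' P φ.hom
    (by simpa using φ.hom_f_zero_comp_π_f_zero) F n
  have h2 := homologyUnop_inv_naturality ((F.mapHomologicalComplex _).map φ.hom) n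
  have h3 := P.homologyMap_homologyToExt (R := R) φ n Y
    ((HomologicalComplex.unopFunctor _ _).map ((F.mapHomologicalComplex _).map φ.hom).op)
    (fun f ↦ rfl)
  have h1' := congrArg Quiver.Hom.unop h1
  simp only [unop_comp] at h1'
  refine (Category.assoc _ _ _).symm.trans ?_
  refine Eq.trans ?_ (Category.assoc _ _ _).symm
  refine Eq.trans ?_ (congrArg ((P.isoExt (R := R) n Y).hom ≫ ·) h3)
  refine Eq.trans (congrArg (· ≫ P'.homologyToExt R n Y) ?_) (Category.assoc _ _ _)
  refine (Category.assoc _ _ _).symm.trans ?_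
  refine Eq.trans (congrArg (· ≫ (HomologicalComplex.homologyUnop _ n).inv) h1') ?_
  refine (Category.assoc _ _ _).trans ?_
  refine Eq.trans ?_ (Category.assoc _ _ _).symm
  exact congrArg ((P.isoLeftDerivedObj F n).inv.unop ≫ ·) h2

end ProjectiveResolution
end CategoryTheory

end

/-! ### Depth, dimension and regularity of powers of a system of parameters. -/

section

open CategoryTheory Abelian IsLocalRing RingTheory.Sequence Pointwise

namespace CMLocalCohomology

section General
variable {R : Type u} [CommRing R]

lemma ringKrullDim_quotient_add_one_le_of_lt {p q : Ideal R} [p.IsPrime] (h : p < q) :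
    ringKrullDim (R ⧸ q) + 1 ≤ ringKrullDim (R ⧸ p) := by
  obtain ⟨a, haq, hap⟩ := Set.exists_of_ssubset h
  refine ringKrullDim_succ_le_of_surjective (Ideal.Quotient.factor h.le)
    (Ideal.Quotient.factor_surjective h.le) (r := Ideal.Quotient.mk p a) ?_ ?_
  · exact mem_nonZeroDivisors_of_ne_zero (by rwa [ne_eq, Ideal.Quotient.eq_zero_iff_mem])
  · simpa [Ideal.Quotient.eq_zero_iff_mem] using haq

lemma ringKrullDim_quotient_le_supportDim {M : Type u} [AddCommGroup M] [Module R M]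
    [Module.Finite R M] {p : PrimeSpectrum R} (hp : p ∈ Module.support R M) :
    ringKrullDim (R ⧸ p.asIdeal) ≤ Module.supportDim R M := by
  rw [Module.supportDim_eq_ringKrullDim_quotient_annihilator]
  have h := Module.mem_support_iff_of_finite.1 hp
  exact ringKrullDim_le_of_surjective (Ideal.Quotient.factor h) (Ideal.Quotient.factor_surjective h)

lemma supportDim_nonpos_of_support_subset
    [IsLocalRing R] {M : Type u} [AddCommGroup M] [Module R M]
    (h : Module.support R M ⊆ PrimeSpectrum.zeroLocus (maximalIdeal R)) :
    Module.supportDim R M ≤ 0 := by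
  have : Subsingleton (Module.support R M) := by
    rw [PrimeSpectrum.zeroLocus_eq_singleton] at h
    exact (Set.subsingleton_singleton.anti h).coe_sort
  exact Order.krullDim_nonpos_of_subsingleton

lemma powIdeal_eq_ofList {d : ℕ} (x : Fin d → R) (n : ℕ) :
    powIdeal x n = Ideal.ofList (List.ofFn fun i ↦ x i ^ n) := by
  simp only [powIdeal, Ideal.ofList, List.mem_ofFn]
  rfl

lemma zeroLocus_powIdeal {d : ℕ} (x : Fin d → R) {n : ℕ} (hn : n ≠ 0) :
    PrimeSpectrum.zeroLocus (powIdeal x n) = PrimeSpectrum.zeroLocus (Set.range x) := by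
  ext p
  simp only [powIdeal, PrimeSpectrum.zeroLocus_span, PrimeSpectrum.mem_zeroLocus,
    Set.range_subset_iff, SetLike.mem_coe, p.2.pow_mem_iff_mem _ (Nat.pos_of_ne_zero hn)]

lemma exists_isRegular_length_eq [IsLocalRing R] {M : Type u} [AddCommGroup M] [Module R M]
    {d : ℕ} (hd : Module.supportDim R M = (d : WithBot ℕ∞))
    (hM : IsCohenMacaulay R M) :
    ∃ rs : List R, (∀ r ∈ rs, r ∈ maximalIdeal R) ∧ IsRegular M rs ∧ d ≤ rs.length := by
  have : Nontrivial M := by simp [← Module.supportDim_ne_bot_iff_nontrivial R, hd]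
  rcases d with _ | d
  · exact ⟨[], by simp, IsRegular.nil R M, by simp⟩
  · have h : depth R M = (d + 1 : ℕ) := by
      have := (hM this).trans hd
      exact_mod_cast this
    -- The supremum is not known to be attained, but exceeding `d` strictly yields a single sequence
    -- of length at least `d + 1`.
    have h' : (d : ℕ∞) < depth R M := by
      rw [h]
      exact_mod_cast Nat.lt_succ_self d
    simp only [depth, lt_iSup_iff] at h'
    obtain ⟨rs, ⟨h1, h2⟩, h3⟩ := h'
    exact ⟨rs, h1, h2, by exact_mod_cast h3⟩

lemma subsingleton_ext_quotSMulTop {M : Type u} [AddCommGroup M] [Module R M]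
    {a : R} (hreg : IsSMulRegular M a) (N : ModuleCat.{u} R)
    (n : ℕ)
    (h : ∀ i < n + 1, Subsingleton (Ext N (ModuleCat.of R M) i)) :
    ∀ i < n, Subsingleton (Ext N (ModuleCat.of R (QuotSMulTop a M)) i) := by
  intro i hi
  have h1 := h i (by omega)
  have h2 := h (i + 1) (by omega)
  have hS := (IsSMulRegular.smulShortComplex_shortExact (M := ModuleCat.of R M) hreg)
  refine ⟨fun x y ↦ ?_⟩
  have key : ∀ x : Ext N (ModuleCat.of R (QuotSMulTop a M)) i, x = 0 := fun x ↦ by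
    obtain ⟨z, rfl⟩ := Ext.covariant_sequence_exact₃ N hS x rfl
      (Subsingleton.elim (α := Ext N (ModuleCat.of R M) (i + 1)) _ _)
    obtain rfl : z = 0 := Subsingleton.elim (α := Ext N (ModuleCat.of R M) i) _ _
    exact Ext.zero_comp N i (Ext.mk₀ ((ModuleCat.of R M).smulShortComplex a).g) i (add_zero i)
  rw [key x, key y]

end General

section Algebra
variable {R : Type u} [CommRing R] [IsNoetherianRing R] [IsLocalRing R]
variable {M : Type u} [AddCommGroup M] [Module R M] [Module.Finite R M]

/-- Let `U ≠ 0` be the elements killed by `p`. Nakayama gives `u ∈ U` outside `𝔪U`. If `u = av`,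
regularity of `a` puts `v` in `U`, so `u ∈ 𝔪U`, a contradiction. Thus `u` is nonzero modulo `aM`,
and its annihilator there contains `p` and `a`. -/
lemma exists_isAssociatedPrime_quotSMulTop {a : R} (ha : a ∈ maximalIdeal R)
    (hreg : IsSMulRegular M a) {p : Ideal R} (hp : IsAssociatedPrime p M) :
    ∃ q : Ideal R, IsAssociatedPrime q (QuotSMulTop a M) ∧ p ≤ q ∧ a ∈ q := by
  let U : Submodule R M := Submodule.torsionBySet R M p
  have hU : U ≠ ⊥ := by
    obtain ⟨hpp, x, hx⟩ := isAssociatedPrime_iff.1 hp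
    intro h
    have hxU : x ∈ U := by
      rw [Submodule.mem_torsionBySet_iff]
      rintro ⟨r, hr⟩
      rw [SetLike.mem_coe, hx, Submodule.mem_colon_singleton] at hr
      simpa using hr
    rw [h, Submodule.mem_bot] at hxU
    exact hpp.ne_top (by rw [hx, hxU]; ext r; simp [Submodule.mem_colon_singleton])
  have hlt : ¬ U ≤ maximalIdeal R • U := fun h ↦
    hU (Submodule.eq_bot_of_le_smul_of_le_jacobson_bot _ _ (IsNoetherian.noetherian U) h
      (maximalIdeal_le_jacobson _))
  obtain ⟨u, huU, hu⟩ := Set.not_subset.1 hlt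
  have hne : (a • (⊤ : Submodule R M)).mkQ u ≠ 0 := by
    rw [Submodule.mkQ_apply, ne_eq, Submodule.Quotient.mk_eq_zero]
    intro h
    obtain ⟨v, -, rfl⟩ := (Submodule.mem_smul_pointwise_iff_exists _ _ _).1 h
    refine hu (Submodule.smul_mem_smul ha ?_)
    refine (Submodule.mem_torsionBySet_iff _ _).2 fun r ↦ hreg ?_
    have := (Submodule.mem_torsionBySet_iff _ _).1 huU r
    simpa [smul_comm a] using this
  obtain ⟨q, hq, hle⟩ := exists_le_isAssociatedPrime_of_isNoetherianRing R _ hne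
  refine ⟨q, hq, fun r hr ↦ hle ?_, hle ?_⟩
  · have := (Submodule.mem_torsionBySet_iff _ _).1 huU ⟨r, hr⟩
    rw [Submodule.mem_colon_singleton, ← map_smul, Submodule.mem_bot]
    exact (congrArg _ this).trans (map_zero _)
  · rw [Submodule.mem_colon_singleton, ← map_smul, Submodule.mem_bot, Submodule.mkQ_apply,
      Submodule.Quotient.mk_eq_zero]
    exact Submodule.smul_mem_pointwise_smul _ _ _ trivial

/-- Passing to `M/aM` replaces `p` by a strictly larger associated prime, as the regular element `a`
avoids `p`; so the dimension drops by at least one each time. -/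
lemma length_le_ringKrullDim_quotient (rs : List R) (hrs : ∀ r ∈ rs, r ∈ maximalIdeal R)
    (hreg : IsWeaklyRegular M rs) {p : Ideal R} (hp : IsAssociatedPrime p M) :
    (rs.length : WithBot ℕ∞) ≤ ringKrullDim (R ⧸ p) := by
  induction rs generalizing M p with
  | nil =>
    have := hp.isPrime
    simpa using ringKrullDim_nonneg_of_nontrivial
  | cons a rs ih =>
    rw [isWeaklyRegular_cons_iff] at hreg
    obtain ⟨q, hq, hpq, haq⟩ := exists_isAssociatedPrime_quotSMulTop (hrs a (by simp)) hreg.1 hp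
    have hap : a ∉ p := fun h ↦ by
      have := (biUnion_associatedPrimes_eq_compl_regular R M).subset
        (Set.mem_biUnion (AssociatedPrimes.mem_iff.2 hp) h)
      exact this hreg.1
    have := hp.isPrime
    refine le_trans ?_ (ringKrullDim_quotient_add_one_le_of_lt
      (lt_of_le_of_ne hpq fun h ↦ hap (h ▸ haq)))
    rw [List.length_cons, Nat.cast_add, Nat.cast_one]
    gcongr
    exact ih (fun r hr ↦ hrs r (by simp [hr])) hreg.2 hq

lemma supportDim_le_add_length (rs : List R) (hrs : ∀ r ∈ rs, r ∈ maximalIdeal R) :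
    Module.supportDim R M ≤
      Module.supportDim R (M ⧸ (Ideal.ofList rs • ⊤ : Submodule R M)) + rs.length := by
  induction rs generalizing M with
  | nil =>
    rw [Ideal.ofList_nil, Submodule.bot_smul]
    simpa using (Module.supportDim_eq_of_equiv (Submodule.quotEquivOfEqBot ⊥ rfl)).ge
  | cons x rs ih =>
    refine (Module.supportDim_le_supportDim_quotSMulTop_succ (hrs x (by simp))).trans ?_
    rw [Module.supportDim_eq_of_equiv (Submodule.quotOfListConsSMulTopEquivQuotSMulTopInner M x _),
      List.length_cons, Nat.cast_add, Nat.cast_one, ← add_assoc]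
    gcongr
    exact ih fun r hr ↦ hrs r (by simp [hr])

/-- If the first element `a` were a zero divisor, it would lie in an associated prime `p`. The `Ext`
vanishing gives a regular sequence one longer than the tail `rs`, so `dim R/p > rs.length`. But `p`
is in the support of `M/aM`, whose dimension is at most `rs.length`. -/
lemma isWeaklyRegular_of_subsingleton_ext [Nontrivial M] (rs : List R)
    (hrs : ∀ r ∈ rs, r ∈ maximalIdeal R)
    (hsupp : Module.support R (M ⧸ (Ideal.ofList rs • ⊤ : Submodule R M)) ⊆
      PrimeSpectrum.zeroLocus (maximalIdeal R))
    (hext : ∀ i < rs.length,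
      Subsingleton (Ext (ModuleCat.of R (R ⧸ maximalIdeal R)) (ModuleCat.of R M) i)) :
    IsWeaklyRegular M rs := by
  induction rs generalizing M with
  | nil => exact .nil R M
  | cons a rs ih =>
    have ha : a ∈ maximalIdeal R := hrs a (by simp)
    have hrs' : ∀ r ∈ rs, r ∈ maximalIdeal R := fun r hr ↦ hrs r (by simp [hr])
    have e := Submodule.quotOfListConsSMulTopEquivQuotSMulTopInner M a rs
    rw [e.support_eq] at hsupp
    have hreg : IsSMulRegular M a := by
      by_contra hna
      have hmem := (biUnion_associatedPrimes_eq_compl_regular R M).ge hna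
      obtain ⟨p, hp, hap⟩ := Set.mem_iUnion₂.1 hmem
      rw [AssociatedPrimes.mem_iff] at hp
      obtain ⟨ss, hlen, hss, hssreg⟩ := ModuleCat.exists_isRegular_of_exists_subsingleton_ext
        (maximalIdeal R) (rs.length + 1) (ModuleCat.of R M)
        (Submodule.top_ne_ideal_smul_of_le_jacobson_annihilator
          (maximalIdeal_le_jacobson _)).symm.lt_top
        (ModuleCat.of R (R ⧸ maximalIdeal R))
        (by rw [Module.support_eq_zeroLocus, Ideal.annihilator_quotient]) hext
      have h1 := length_le_ringKrullDim_quotient ss hss hssreg.toIsWeaklyRegular hp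
      have hpp := hp.isPrime
      have hsup : (⟨p, hpp⟩ : PrimeSpectrum R) ∈ Module.support R (QuotSMulTop a M) := by
        rw [Module.support_quotSMulTop]
        refine ⟨Module.mem_support_iff_of_finite.2 ?_, by simpa using hap⟩
        rw [← Submodule.annihilator_top]
        exact hp.annihilator_le
      have h2 := (ringKrullDim_quotient_le_supportDim hsup).trans (supportDim_le_add_length rs hrs')
      have h3 := supportDim_nonpos_of_support_subset hsupp
      have h4 : (ss.length : WithBot ℕ∞) ≤ (rs.length : ℕ) := by
        refine h1.trans (h2.trans ?_)
        refine (add_le_add_left h3 _).trans ?_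
        simp
      have h5 : ss.length ≤ rs.length := by exact_mod_cast h4
      omega
    have := nontrivial_quotSMulTop_of_mem_maximalIdeal M ha
    exact .cons hreg (ih hrs' hsupp (subsingleton_ext_quotSMulTop hreg _ _ hext))

/-- The chain `𝔪ⁿM` stabilises, and by Nakayama its stable value is zero. -/
lemma support_subset_of_isFiniteLength (h : IsFiniteLength R M) :
    Module.support R M ⊆ PrimeSpectrum.zeroLocus (maximalIdeal R) := by
  obtain ⟨-, _⟩ := isFiniteLength_iff_isNoetherian_isArtinian.1 h
  let f : ℕ →o (Submodule R M)ᵒᵈ :=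
    ⟨fun n ↦ OrderDual.toDual (maximalIdeal R ^ n • ⊤ : Submodule R M),
      fun i j hij ↦ Submodule.smul_mono_left (Ideal.pow_le_pow_right hij)⟩
  obtain ⟨n, hn⟩ := IsArtinian.monotone_stabilizes f
  have h0 : (maximalIdeal R ^ n • ⊤ : Submodule R M) = ⊥ := by
    refine Submodule.eq_bot_of_le_smul_of_le_jacobson_bot (maximalIdeal R) _
      (IsNoetherian.noetherian _) ?_ (maximalIdeal_le_jacobson _)
    rw [← Submodule.mul_smul, ← pow_succ']
    exact (hn (n + 1) (Nat.le_succ n)).ge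
  rw [Module.support_eq_zeroLocus, PrimeSpectrum.zeroLocus_subset_zeroLocus_iff]
  intro r hr
  refine ⟨n, ?_⟩
  rw [Module.mem_annihilator]
  intro m
  have : r ^ n • m ∈ (maximalIdeal R ^ n • ⊤ : Submodule R M) :=
    Submodule.smul_mem_smul (Ideal.pow_mem_pow hr n) trivial
  rwa [h0] at this

lemma subsingleton_ext_of_isCohenMacaulay {d : ℕ}
    (hd : Module.supportDim R M = (d : WithBot ℕ∞)) (hM : IsCohenMacaulay R M)
    (N : ModuleCat.{u} R) [Module.Finite R N]
    (hN : Module.support R N ⊆ PrimeSpectrum.zeroLocus (maximalIdeal R)) :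
    ∀ i < d, Subsingleton (Ext N (ModuleCat.of R M) i) := by
  intro i hi
  have : Nontrivial M := by simp [← Module.supportDim_ne_bot_iff_nontrivial R, hd]
  obtain ⟨rs, hrs, hreg, hlen⟩ := exists_isRegular_length_eq hd hM
  exact ModuleCat.subsingleton_ext_of_exists_isRegular (maximalIdeal R) N hN (ModuleCat.of R M)
    (Submodule.top_ne_ideal_smul_of_le_jacobson_annihilator
      (maximalIdeal_le_jacobson _)).symm.lt_top rs hrs hreg i (hi.trans_le hlen)

lemma IsSystemOfParameters.support_quotPow_subset {d : ℕ} {x : Fin d → R}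
    (hx : IsSystemOfParameters M x) {n : ℕ} (hn : n ≠ 0) :
    Module.support R (QuotPow x n M) ⊆ PrimeSpectrum.zeroLocus (maximalIdeal R) := by
  rw [Module.support_quotient, zeroLocus_powIdeal x hn, ← PrimeSpectrum.zeroLocus_span,
    ← Module.support_quotient]
  exact support_subset_of_isFiniteLength hx.finite_length

lemma IsSystemOfParameters.isWeaklyRegular_pow {d : ℕ} {x : Fin d → R}
    (hx : IsSystemOfParameters M x) (hM : IsCohenMacaulay R M) {n : ℕ} (hn : n ≠ 0) :
    IsWeaklyRegular M (List.ofFn fun i ↦ x i ^ n) := by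
  have : Nontrivial M := by simp [← Module.supportDim_ne_bot_iff_nontrivial R, hx.dim_eq]
  refine isWeaklyRegular_of_subsingleton_ext _ ?_ ?_ ?_
  · simp only [List.mem_ofFn]
    rintro _ ⟨i, rfl⟩
    exact Ideal.pow_mem_of_mem _ (hx.mem_maximalIdeal i) _ (Nat.pos_of_ne_zero hn)
  · rw [← powIdeal_eq_ofList]
    exact hx.support_quotPow_subset hn
  · rw [List.length_ofFn]
    exact subsingleton_ext_of_isCohenMacaulay hx.dim_eq hM _
      (by rw [Module.support_eq_zeroLocus]; exact (by rw [Ideal.annihilator_quotient]))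

end Algebra

end CMLocalCohomology

end

/-! ### The extension classes of the quotients by powers. -/

noncomputable section

open CategoryTheory Abelian IsLocalRing RingTheory.Sequence

namespace CMLocalCohomology

section Koszul
variable {R : Type u} [CommRing R]

lemma prod_mul_mem_powIdeal_succ {d : ℕ} (x : Fin d → R) (n : ℕ) {r : R} (hr : r ∈ powIdeal x n) :
    (∏ i, x i) * r ∈ powIdeal x (n + 1) := by
  induction hr using Submodule.span_induction with
  | mem r hr =>
    obtain ⟨i, rfl⟩ := hr
    obtain ⟨c, hc⟩ := Finset.dvd_prod_of_mem x (Finset.mem_univ i)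
    rw [hc, show x i * c * x i ^ n = c * x i ^ (n + 1) by ring]
    exact Ideal.mul_mem_left _ _ (Ideal.subset_span ⟨i, rfl⟩)
  | zero => simp
  | add r s _ _ hr hs => rw [mul_add]; exact add_mem hr hs
  | smul a r _ hr => rw [smul_eq_mul, mul_left_comm]; exact Ideal.mul_mem_left _ _ hr

variable (M : Type u) [AddCommGroup M] [Module R M]

lemma smul_top_le_comap_lsmul {I J : Ideal R} {a : R} (h : ∀ r ∈ I, a * r ∈ J) :
    (I • ⊤ : Submodule R M) ≤ (J • ⊤ : Submodule R M).comap (LinearMap.lsmul R M a) := by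
  refine Submodule.smul_le.2 fun r hr m _ ↦ ?_
  rw [Submodule.mem_comap, LinearMap.lsmul_apply, smul_smul]
  exact Submodule.smul_mem_smul (h r hr) trivial

/-- Multiplication by `x₁ ⋯ x_d` as a map from `M/(x₁ⁿ, …, x_dⁿ)M` to
`M/(x₁ⁿ⁺¹, …, x_dⁿ⁺¹)M`. -/
def mulProdQuot {d : ℕ} (x : Fin d → R) (n : ℕ) : QuotPow x n M →ₗ[R] QuotPow x (n + 1) M :=
  Submodule.mapQ _ _ (LinearMap.lsmul R M (∏ i, x i))
    (smul_top_le_comap_lsmul M fun _ ↦ prod_mul_mem_powIdeal_succ x n)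

lemma powIdeal_castSucc {d : ℕ} (x : Fin (d + 1) → R) (n : ℕ) :
    powIdeal x n = powIdeal (x ∘ Fin.castSucc) n ⊔ Ideal.span {x (Fin.last d) ^ n} := by
  rw [powIdeal, powIdeal, ← Ideal.span_union]
  congr 1
  ext r
  simp only [Set.mem_range, Set.mem_union, Set.mem_singleton_iff, Fin.exists_fin_succ',
    Function.comp_apply, eq_comm]

/-- The complex `W' → W' → W → 0` with `W' = M/(x₁ⁿ, …, x_dⁿ)M`, `W = M/(x₁ⁿ, …, x_{d+1}ⁿ)M` and
first map multiplication by `x_{d+1}ⁿ`. -/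
@[simps]
def quotPowShortComplex {d : ℕ} (x : Fin (d + 1) → R) (n : ℕ) : ShortComplex (ModuleCat.{u} R) where
  X₁ := ModuleCat.of R (QuotPow (x ∘ Fin.castSucc) n M)
  X₂ := ModuleCat.of R (QuotPow (x ∘ Fin.castSucc) n M)
  X₃ := ModuleCat.of R (QuotPow x n M)
  f := x (Fin.last d) ^ n • 𝟙 _
  g := ModuleCat.ofHom (Submodule.factor (Submodule.smul_mono_left
    ((powIdeal_castSucc x n).ge.trans' le_sup_left)))
  zero := by
    ext m
    change Submodule.Quotient.mk (x (Fin.last d) ^ n • m) = (0 : QuotPow x n M)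
    rw [Submodule.Quotient.mk_eq_zero]
    exact Submodule.smul_mem_smul (Ideal.subset_span ⟨_, rfl⟩) trivial

variable {M} in
lemma shortExact_quotPowShortComplex {d : ℕ} (x : Fin (d + 1) → R) (n : ℕ)
    (h : IsSMulRegular (QuotPow (x ∘ Fin.castSucc) n M) (x (Fin.last d) ^ n)) :
    (quotPowShortComplex M x n).ShortExact := by
  refine ModuleCat.shortComplex_shortExact _ ?_ h ?_
  · intro w
    refine ⟨fun hw ↦ ?_, ?_⟩
    · obtain ⟨m, rfl⟩ := Submodule.Quotient.mk_surjective _ w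
      have hm : m ∈ (powIdeal x n • ⊤ : Submodule R M) := (Submodule.Quotient.mk_eq_zero _).1 hw
      rw [powIdeal_castSucc, Submodule.sup_smul, Submodule.ideal_span_singleton_smul] at hm
      obtain ⟨y, hy, z, hz, rfl⟩ := Submodule.mem_sup.1 hm
      obtain ⟨v, -, rfl⟩ := (Submodule.mem_smul_pointwise_iff_exists _ _ _).1 hz
      refine ⟨Submodule.Quotient.mk v, ?_⟩
      change Submodule.Quotient.mk (x (Fin.last d) ^ n • v) = _
      rw [Submodule.Quotient.eq]
      simpa using hy
    · rintro ⟨v, rfl⟩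
      exact congr($((quotPowShortComplex M x n).zero) v)
  · exact Submodule.factor_surjective (Submodule.smul_mono_left
      ((powIdeal_castSucc x n).ge.trans' le_sup_left))

/-- Multiplication by products of the `x_i` as a morphism between the complexes
`quotPowShortComplex`. -/
@[simps]
def quotPowShortComplexMap {d : ℕ} (x : Fin (d + 1) → R) (n : ℕ) :
    quotPowShortComplex M x n ⟶ quotPowShortComplex M x (n + 1) where
  τ₁ := ModuleCat.ofHom (mulProdQuot M (x ∘ Fin.castSucc) n)
  -- The extra factor belongs to the middle term and not to the first: it absorbs the change of the
  -- first map from the `n`-th to the `(n + 1)`-st power.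
  τ₂ := x (Fin.last d) • ModuleCat.ofHom (mulProdQuot M (x ∘ Fin.castSucc) n)
  τ₃ := ModuleCat.ofHom (mulProdQuot M x n)
  comm₁₂ := by
    ext w
    obtain ⟨m, rfl⟩ := Submodule.Quotient.mk_surjective _ w
    change Submodule.Quotient.mk (x (Fin.last d) ^ (n + 1) • (∏ i : Fin d, x i.castSucc) • m) =
      Submodule.Quotient.mk
        (x (Fin.last d) • (∏ i : Fin d, x i.castSucc) • x (Fin.last d) ^ n • m)
    simp only [smul_smul]
    congr 2
    ring
  comm₂₃ := by
    ext w
    obtain ⟨m, rfl⟩ := Submodule.Quotient.mk_surjective _ w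
    change Submodule.Quotient.mk (x (Fin.last d) • (∏ i : Fin d, x i.castSucc) • m) =
      Submodule.Quotient.mk ((∏ i, x i) • m)
    rw [smul_smul, Fin.prod_univ_castSucc, mul_comm]

variable {M} in
lemma quotPow_zero_sup (x : Fin 0 → R) (n : ℕ) : (powIdeal x n • ⊤ : Submodule R M) = ⊥ := by
  rw [powIdeal, Set.range_eq_empty, Ideal.span_empty, Submodule.bot_smul]

variable {M} in
-- The index `n` stands for the exponent `n + 1`. Only `i = 0` is used later, but the induction on
-- `d` needs all `i`: a connecting homomorphism raises `i` by one while `j` is fixed.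
theorem exists_ext_classes {d : ℕ} (x : Fin d → R)
    (hreg : ∀ n, IsWeaklyRegular M (List.ofFn fun i ↦ x i ^ (n + 1))) :
    ∃ ξ : ∀ n, Ext (ModuleCat.of R (QuotPow x (n + 1) M)) (ModuleCat.of R M) d,
      (∀ n, (Ext.mk₀ (ModuleCat.ofHom (mulProdQuot M x (n + 1)))).comp (ξ (n + 1)) (zero_add d) =
        ξ n) ∧
      ∀ (n : ℕ) (N : ModuleCat.{u} R) (i j : ℕ) (h : i + d = j)
        (_ : ∀ l < j, Subsingleton (Ext N (ModuleCat.of R M) l)),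
        (∀ e : Ext N (ModuleCat.of R (QuotPow x (n + 1) M)) i, e.comp (ξ n) h = 0 → e = 0) ∧
        (powIdeal x (n + 1) ≤ Module.annihilator R N → ∀ y : Ext N (ModuleCat.of R M) j,
          ∃ e : Ext N (ModuleCat.of R (QuotPow x (n + 1) M)) i, e.comp (ξ n) h = y) := by
  induction d with
  | zero =>
    let φ (n : ℕ) : ModuleCat.of R (QuotPow x (n + 1) M) ≅ ModuleCat.of R M :=
      (Submodule.quotEquivOfEqBot _ (quotPow_zero_sup x (n + 1))).toModuleIso
    refine ⟨fun n ↦ Ext.mk₀ (φ n).hom, fun n ↦ ?_, fun n N i j h _ ↦ ?_⟩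
    · rw [Ext.mk₀_comp_mk₀]
      congr 1
      ext m
      change (∏ i, x i) • m = m
      simp
    · obtain rfl : i = j := h
      refine ⟨fun e he ↦ ?_, fun _ y ↦ ⟨y.comp (Ext.mk₀ (φ n).inv) (add_zero _), ?_⟩⟩
      · have := congrArg (fun z ↦ z.comp (Ext.mk₀ (φ n).inv) (add_zero _)) he
        simpa using this
      · simp
  | succ d ih =>
    have hreg' (n : ℕ) :
        IsWeaklyRegular M (List.ofFn fun i ↦ (x ∘ Fin.castSucc) i ^ (n + 1)) ∧
        IsSMulRegular (QuotPow (x ∘ Fin.castSucc) (n + 1) M) (x (Fin.last d) ^ (n + 1)) := by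
      have := hreg n
      rw [List.ofFn_succ', List.concat_eq_append, isWeaklyRegular_append_iff,
        isWeaklyRegular_singleton_iff] at this
      refine ⟨this.1, ?_⟩
      change IsSMulRegular (M ⧸ (powIdeal _ _ • ⊤ : Submodule R M)) _
      rw [powIdeal_eq_ofList]
      exact this.2
    have hS (n : ℕ) := shortExact_quotPowShortComplex (M := M) x (n + 1) (hreg' n).2
    obtain ⟨ξ, hξ, hbij⟩ := ih (x ∘ Fin.castSucc) fun n ↦ (hreg' n).1
    refine ⟨fun n ↦ (hS n).extClass.comp (ξ n) (add_comm 1 d), fun n ↦ ?_, fun n N i j h hN ↦ ?_⟩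
    · refine (Ext.comp_assoc _ (hS (n + 1)).extClass (ξ (n + 1)) (zero_add 1) _
        (by omega)).symm.trans ?_
      -- Naturality of the extension class trades the product of all `x_i` for the product without
      -- the last, to which the induction hypothesis applies.
      refine (congrArg (fun z ↦ Ext.comp z (ξ (n + 1)) (add_comm 1 d))
        ((hS n).extClass_naturality (hS (n + 1)) (quotPowShortComplexMap M x (n + 1))).symm).trans ?_
      refine (Ext.comp_assoc _ _ _ (add_zero 1) (zero_add d) (by omega)).trans ?_
      exact congrArg (fun z ↦ (hS n).extClass.comp z (add_comm 1 d)) (hξ n)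
    · obtain ⟨hinj, hsurj⟩ := hbij n N (i + 1) j (by omega) hN
      have hinj' := (hbij n N i (i + d) rfl fun l hl ↦ hN l (by omega)).1
      refine ⟨fun e he ↦ ?_, fun hI y ↦ ?_⟩
      · replace he := (Ext.comp_assoc e (hS n).extClass (ξ n) rfl (add_comm 1 d)
          (by omega)).trans he
        obtain ⟨z, rfl⟩ := Ext.covariant_sequence_exact₃ N (hS n) e rfl (hinj _ he)
        -- The element `z` embeds in `Ext^{i+d}(N, M)`, which vanishes because `i + d < j`.
        have hz : z = 0 := hinj' z (@Subsingleton.elim _ (hN (i + d) (by omega)) _ _)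
        rw [hz, Ext.zero_comp]
        rfl
      · rw [powIdeal_castSucc, sup_le_iff, Ideal.span_singleton_le_iff_mem] at hI
        obtain ⟨e', rfl⟩ := hsurj hI.1 y
        -- The power of the last `x_i` kills `N`, so it acts as zero on `Ext`, and every `e'` is in
        -- the image of the connecting homomorphism.
        obtain ⟨e, rfl⟩ := Ext.covariant_sequence_exact₁ N (hS n) e'
          congr($(Ext.postcomp_smul_id_eq_zero_of_mem_annihilator hI.2 (i + 1)) e') rfl
        exact ⟨e, (Ext.comp_assoc _ _ _ _ _ (by omega)).symm⟩

end Koszul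
end CMLocalCohomology

end

/-! ### Local cohomology as a filtered colimit, in terms of elements. -/

noncomputable section

open CategoryTheory Abelian IsLocalRing Limits Opposite

namespace CMLocalCohomology

section Colimit
variable {R : Type u} [CommRing R]

/-- The natural map `R/I → R/J` for `I ≤ J`. -/
def quotFactor {I J : Ideal R} (h : I ≤ J) : ModuleCat.of R (R ⧸ I) ⟶ ModuleCat.of R (R ⧸ J) :=
  ModuleCat.ofHom (Submodule.mapQ I J LinearMap.id h)

lemma exists_localCohomology_cocone (J : Ideal R) (d : ℕ) (M : ModuleCat.{u} R) :
    ∃ κ : ∀ t : ℕ, Abelian.Ext (ModuleCat.of R (R ⧸ J ^ t)) M d →ₗ[R]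
        (localCohomology J d).obj M,
      (∀ (s t : ℕ) (h : s ≤ t) (e : Abelian.Ext (ModuleCat.of R (R ⧸ J ^ s)) M d),
        κ t ((Ext.mk₀ (quotFactor (Ideal.pow_le_pow_right h))).comp e (zero_add d)) = κ s e) ∧
      (∀ z, ∃ t e, κ t e = z) ∧
      ∀ (t : ℕ) (e : Abelian.Ext (ModuleCat.of R (R ⧸ J ^ t)) M d), κ t e = 0 →
        ∃ (s : ℕ) (h : t ≤ s),
          (Ext.mk₀ (quotFactor (Ideal.pow_le_pow_right h))).comp e (zero_add d) = 0 := by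
  let D := localCohomology.diagram (localCohomology.idealPowersDiagram J) d
  have := localCohomology.hasColimitDiagram.{u, 0} (localCohomology.idealPowersDiagram J) d
  let ev := (evaluation (ModuleCat.{u} R) (ModuleCat.{u} R)).obj M
  let F : ℕᵒᵖᵒᵖ ⥤ ModuleCat.{u} R := D ⋙ ev
  let c : Cocone F := ev.mapCocone (colimit.cocone D)
  let hc : IsColimit c := isColimitOfPreserves ev (colimit.isColimit D)
  have : PreservesFilteredColimitsOfSize.{0, 0} (forget (ModuleCat.{u} R)) :=
    preservesFilteredColimitsOfSize_shrink.{0, u, 0, u} _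
  let P (t : ℕ) := projectiveResolution (ModuleCat.of R (R ⧸ J ^ t))
  let Θ (t : ℕ) : F.obj (op (op t)) ≃ₗ[R] Abelian.Ext (ModuleCat.of R (R ⧸ J ^ t)) M d :=
    ((P t).extIsoExt R d M).toLinearEquiv
  have hΘ (s t : ℕ) (h : s ≤ t) (e : F.obj (op (op s))) :
      Θ t (F.map (homOfLE h).op.op e) =
        (Ext.mk₀ (quotFactor (Ideal.pow_le_pow_right h))).comp (Θ s e) (zero_add d) :=
    congr($((P s).extIsoExt_naturality (R := R) (P t)
      (quotFactor (Ideal.pow_le_pow_right h)) d M) e)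
  let κ (t : ℕ) : Abelian.Ext (ModuleCat.of R (R ⧸ J ^ t)) M d →ₗ[R] c.pt :=
    (c.ι.app (op (op t))).hom ∘ₗ (Θ t).symm.toLinearMap
  have hκ (t : ℕ) (e : F.obj (op (op t))) : κ t (Θ t e) = c.ι.app (op (op t)) e :=
    congrArg (c.ι.app (op (op t))) ((Θ t).symm_apply_apply e)
  refine ⟨κ, fun s t h e ↦ ?_, fun z ↦ ?_, fun t e he ↦ ?_⟩
  · obtain ⟨e, rfl⟩ := (Θ s).surjective e
    rw [← hΘ s t h]
    refine (hκ t _).trans (Eq.trans ?_ (hκ s e).symm)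
    exact congr($(c.w (homOfLE h).op.op) e)
  · obtain ⟨t, e, rfl⟩ := Concrete.isColimit_exists_rep F hc z
    exact ⟨t.unop.unop, _, hκ _ e⟩
  · obtain ⟨e, rfl⟩ := (Θ t).surjective e
    replace he := (hκ t e).symm.trans he
    obtain ⟨s, f, g, h⟩ := Concrete.isColimit_exists_of_rep_eq F hc e 0
      (he.trans (map_zero (c.ι.app (op (op t))).hom).symm)
    refine ⟨s.unop.unop, leOfHom f.unop.unop, (hΘ t s.unop.unop (leOfHom f.unop.unop) e).symm.trans ?_⟩
    rw [show (homOfLE (leOfHom f.unop.unop)).op.op = f from rfl, h]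
    exact (congrArg (Θ s.unop.unop) (map_zero (F.map g).hom)).trans (map_zero _)

end Colimit
end CMLocalCohomology

end

/-! ### Construction of the maps into local cohomology and their images. -/

noncomputable section

open CategoryTheory Abelian IsLocalRing

namespace CMLocalCohomology

section Main

/-- The map `W → Hom(R/I, W)` sending `w` to the homomorphism with `1 ↦ w`, when `IW = 0`. -/
def cyclicHom {R : Type u} [CommRing R] {W : Type u} [AddCommGroup W] [Module R W] {I : Ideal R}
    (h : I ≤ Module.annihilator R W) : W →ₗ[R] (ModuleCat.of R (R ⧸ I) ⟶ ModuleCat.of R W) where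
  toFun w := ModuleCat.ofHom (Submodule.liftQ I (LinearMap.toSpanSingleton R W w)
    fun r hr ↦ Module.mem_annihilator.1 (h hr) w)
  map_add' w w' := by
    ext
    change (1 : R) • (w + w') = (1 : R) • w + (1 : R) • w'
    rw [smul_add]
  map_smul' r w := by
    ext
    change (1 : R) • r • w = r • (1 : R) • w
    rw [smul_comm]

lemma cyclicHom_one {R : Type u} [CommRing R] {W : Type u} [AddCommGroup W] [Module R W]
    {I : Ideal R} (h : I ≤ Module.annihilator R W) (w : W) :
    cyclicHom h w (1 : R ⧸ I) = w :=
  one_smul R w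

lemma hom_ext_one {R : Type u} [CommRing R] {W : ModuleCat.{u} R} {I : Ideal R}
    {f g : ModuleCat.of R (R ⧸ I) ⟶ W} (h : f (1 : R ⧸ I) = g (1 : R ⧸ I)) : f = g := by
  ext
  exact h

lemma le_annihilator_of_smul_top {R : Type u} [CommRing R] (M : Type u) [AddCommGroup M]
    [Module R M] (I : Ideal R) :
    I ≤ Module.annihilator R (M ⧸ (I • ⊤ : Submodule R M)) := by
  rw [Submodule.annihilator_quotient]
  exact fun r hr ↦ Submodule.mem_colon.2 fun m hm ↦ Submodule.smul_mem_smul hr hm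

variable {R : Type u} [CommRing R] [IsNoetherianRing R] [IsLocalRing R]
  {M : Type u} [AddCommGroup M] [Module R M] [Module.Finite R M]

theorem exists_quotPow_to_localCohomology {d : ℕ} {x : Fin d → R} (hx : IsSystemOfParameters M x)
    (hM : IsCohenMacaulay R M) :
    ∃ α : ∀ n : ℕ, QuotPow x (n + 1) M →ₗ[R] H (R := R) d M,
      (∀ n, Function.Injective (α n)) ∧
      (∀ n, LinearMap.range (α n) = annPow x (n + 1) (H (R := R) d M)) ∧
      ∀ n w, α (n + 1) (mulProdQuot M x (n + 1) w) = α n w := by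
  obtain ⟨κ, hκ, hκsurj, hκzero⟩ :=
    exists_localCohomology_cocone (maximalIdeal R) d (ModuleCat.of R M)
  obtain ⟨ξ, hξ, hbij⟩ := exists_ext_classes (M := M) x
    fun n ↦ hx.isWeaklyRegular_pow hM n.succ_ne_zero
  have hvan (I : Ideal R) (t : ℕ) (hI : maximalIdeal R ^ t ≤ I) :
      ∀ l < d, Subsingleton (Ext (ModuleCat.of R (R ⧸ I)) (ModuleCat.of R M) l) := by
    refine subsingleton_ext_of_isCohenMacaulay hx.dim_eq hM _ ?_
    rw [Module.support_eq_zeroLocus, PrimeSpectrum.zeroLocus_subset_zeroLocus_iff,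
      Ideal.annihilator_quotient]
    exact fun r hr ↦ ⟨t, hI (Ideal.pow_mem_pow hr t)⟩
  have hT (n : ℕ) : ∃ t, maximalIdeal R ^ t ≤ Module.annihilator R (QuotPow x (n + 1) M) := by
    have h := hx.support_quotPow_subset n.succ_ne_zero
    rw [Module.support_eq_zeroLocus, PrimeSpectrum.zeroLocus_subset_zeroLocus_iff] at h
    exact Ideal.exists_pow_le_of_le_radical_of_fg h (IsNoetherian.noetherian _)
  choose T hT using hT
  let α (n : ℕ) : QuotPow x (n + 1) M →ₗ[R] H (R := R) d M :=
    κ (T n) ∘ₗ (Ext.postcompOfLinear (ξ n) R _ (zero_add d)) ∘ₗ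
      (Ext.linearEquiv₀ (R := R)).symm.toLinearMap ∘ₗ cyclicHom (hT n)
  have hα (n t : ℕ) (φ : ModuleCat.of R (R ⧸ maximalIdeal R ^ t) ⟶
      ModuleCat.of R (QuotPow x (n + 1) M)) :
      κ t ((Ext.mk₀ φ).comp (ξ n) (zero_add d)) = α n (φ (1 : R ⧸ maximalIdeal R ^ t)) := by
    change _ = κ (T n) ((Ext.mk₀ (cyclicHom (hT n) _)).comp (ξ n) (zero_add d))
    -- At a common stage both sides come from maps out of one cyclic module with the same value at
    -- 1. So `α n` does not depend on the chosen `T n`.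
    rw [← hκ t (max t (T n)) (le_max_left _ _), ← hκ (T n) (max t (T n)) (le_max_right _ _),
      Ext.mk₀_comp_mk₀_assoc, Ext.mk₀_comp_mk₀_assoc]
    congr 3
    refine hom_ext_one ?_
    exact (cyclicHom_one (hT n) _).symm
  have hα' (n t : ℕ) (ht : maximalIdeal R ^ t ≤ Module.annihilator R (QuotPow x (n + 1) M))
      (w : QuotPow x (n + 1) M) :
      α n w = κ t ((Ext.mk₀ (cyclicHom ht w)).comp (ξ n) (zero_add d)) := by
    rw [hα, cyclicHom_one]
  have hinj (n : ℕ) : Function.Injective (α n) := by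
    refine (injective_iff_map_eq_zero _).2 fun w hw ↦ ?_
    rw [hα' n _ (hT n)] at hw
    obtain ⟨s, hs, h⟩ := hκzero _ _ hw
    rw [Ext.mk₀_comp_mk₀_assoc] at h
    have h0 := (hbij n (ModuleCat.of R (R ⧸ maximalIdeal R ^ s)) 0 d (zero_add d)
      (hvan _ s le_rfl)).1 _ h
    rw [Ext.mk₀_eq_zero_iff] at h0
    exact (cyclicHom_one (hT n) w).symm.trans congr($h0 (1 : R ⧸ maximalIdeal R ^ s))
  have hcompat (n : ℕ) (w : QuotPow x (n + 1) M) :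
      α (n + 1) (mulProdQuot M x (n + 1) w) = α n w := by
    rw [hα' n _ (hT n), ← hξ n, Ext.mk₀_comp_mk₀_assoc, hα]
    exact congrArg (fun v ↦ α (n + 1) (mulProdQuot M x (n + 1) v)) (cyclicHom_one (hT n) w).symm
  refine ⟨α, hinj, fun n ↦ le_antisymm ?_ ?_, hcompat⟩
  · rintro _ ⟨w, rfl⟩
    rw [Submodule.mem_torsionBySet_iff]
    rintro ⟨r, hr⟩
    change r • α n w = 0
    rw [← map_smul, Module.mem_annihilator.1 (le_annihilator_of_smul_top M _ hr), map_zero]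
  · intro z hz
    obtain ⟨k, w, rfl⟩ : ∃ k w, α k w = z := by
      obtain ⟨t, e, rfl⟩ := hκsurj z
      -- The class `ξ t` has exponent `t + 1`, which is enough to kill `R/𝔪ᵗ`; hence `k = t` serves.
      have ht : powIdeal x (t + 1) ≤ Module.annihilator R (R ⧸ maximalIdeal R ^ t) := by
        rw [Ideal.annihilator_quotient, powIdeal, Ideal.span_le]
        rintro _ ⟨i, rfl⟩
        exact Ideal.pow_le_pow_right t.le_succ (Ideal.pow_mem_pow (hx.mem_maximalIdeal i) _)
      obtain ⟨e', rfl⟩ := (hbij t (ModuleCat.of R (R ⧸ maximalIdeal R ^ t)) 0 d (zero_add d)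
        (hvan _ t le_rfl)).2 ht e
      obtain ⟨φ, rfl⟩ := (Ext.mk₀_bijective _ _).2 e'
      exact ⟨t, _, (hα t t φ).symm⟩
    -- Injectivity of `α k` carries the vanishing from `z` back to `w`. The power of `𝔪` is kept in
    -- the ideal so that `hvan` applies to the quotient.
    have hw : maximalIdeal R ^ T k ⊔ powIdeal x (n + 1) ≤
        LinearMap.ker (LinearMap.toSpanSingleton R (QuotPow x (k + 1) M) w) := by
      refine sup_le (fun r hr ↦ Module.mem_annihilator.1 (hT k hr) w) fun r hr ↦ hinj k ?_
      rw [LinearMap.toSpanSingleton_apply, map_smul, map_zero]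
      exact (Submodule.mem_torsionBySet_iff _ _).1 hz ⟨r, hr⟩
    let φ : ModuleCat.of R (R ⧸ (maximalIdeal R ^ T k ⊔ powIdeal x (n + 1))) ⟶
        ModuleCat.of R (QuotPow x (k + 1) M) :=
      ModuleCat.ofHom (Submodule.liftQ _ (LinearMap.toSpanSingleton R (QuotPow x (k + 1) M) w) hw)
    have hφ : quotFactor le_sup_left ≫ φ = cyclicHom (hT k) w := hom_ext_one rfl
    obtain ⟨e, he⟩ := (hbij n (ModuleCat.of R (R ⧸ (maximalIdeal R ^ T k ⊔ powIdeal x (n + 1)))) 0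
      d (zero_add d) (hvan _ (T k) le_sup_left)).2
      (by rw [Ideal.annihilator_quotient]; exact le_sup_right)
      ((Ext.mk₀ φ).comp (ξ k) (zero_add d))
    obtain ⟨ψ, rfl⟩ := (Ext.mk₀_bijective _ _).2 e
    rw [hα' k _ (hT k), ← hφ, ← Ext.mk₀_comp_mk₀_assoc, ← he, Ext.mk₀_comp_mk₀_assoc, hα]
    exact ⟨_, rfl⟩

end Main
end CMLocalCohomology

end

theorem corollary2p2 {R : Type u} [CommRing R] [IsNoetherianRing R] [IsLocalRing R]
    {M : Type u} [AddCommGroup M] [Module R M] [Module.Finite R M]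
    {d : ℕ} (hd : Module.supportDim R M = (d : WithBot ℕ∞))
    (x : Fin d → R) (hx : CMLocalCohomology.IsSystemOfParameters M x)
    (hM : CMLocalCohomology.IsCohenMacaulay R M) :
    ∃ α : ∀ n : ℕ, 1 ≤ n →
        CMLocalCohomology.QuotPow x n M ≃ₗ[R]
          CMLocalCohomology.annPow x n (CMLocalCohomology.H (R := R) d M),
      ∀ (n : ℕ) (hn : 1 ≤ n),
        (α n hn).toLinearMap ∘ₗ CMLocalCohomology.natProj x n M =
          CMLocalCohomology.mulProd x n (CMLocalCohomology.H (R := R) d M) ∘ₗ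
            (α (n + 1) (Nat.le_add_left 1 n)).toLinearMap := by
  obtain ⟨α, hinj, hrange, hα⟩ := CMLocalCohomology.exists_quotPow_to_localCohomology hx hM
  let β (n : ℕ) : CMLocalCohomology.QuotPow x (n + 1) M ≃ₗ[R]
      CMLocalCohomology.annPow x (n + 1) (CMLocalCohomology.H (R := R) d M) :=
    LinearEquiv.ofInjective (α n) (hinj n) ≪≫ₗ LinearEquiv.ofEq _ _ (hrange n)
  refine ⟨fun | n + 1, _ => β n, ?_⟩
  rintro (_ | n) hn
  · omega
  · ext m
    change α n (Submodule.Quotient.mk m) = (∏ i, x i) • α (n + 1) (Submodule.Quotient.mk m)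
    -- Projecting down and then multiplying back up is multiplication by `x₁⋯x_d` on the larger
    -- quotient.
    rw [← hα, ← map_smul]
    rfl
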